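/- Let $K$ be a CM field with ring of integers $\mathcal{O}_K$, and let $\sigma\colon K\to K$ be its canonical involution, so that $\varphi\circ\sigma=\overline{\varphi}$ for every embedding $\varphi\colon K\hookrightarrow\mathbb{C}$. Let $n\ge 1$, let $\Lambda$ be a free $\mathcal{O}_K$-module of rank $n+1$, and let $h\colon\Lambda\times\Lambda\to\mathcal{O}_K$ be a non-degenerate biadditive form that is $\mathcal{O}_K$-linear in its first argument and satisfies $h(y,x)=\sigma(h(x,y))$ for all $x,y\in\Lambda$. For an embedding $\varphi\colon K\hookrightarrow\mathbb{C}$, let $V_\varphi=\Lambda\otimes_{\mathcal{O}_K,\varphi}\mathbb{C}$, and let $h_\varphi\colon V_\varphi\times V_\varphi\to\mathbb{C}$ be the hermitian form induced by $h$. Assume that $(K,\Lambda)$ is an admissible hermitian lattice, that is: 1. the different ideal $\mathfrak{D}_K\subset\mathcal{O}_K$ is generated by an element $\eta\in\mathcal{O}_K$ with $\sigma(\eta)=-\eta$; 2. there is an embedding $\tau\colon K\hookrightarrow\mathbb{C}$ such that $h_\tau$ has signature $(n,1)$, while $h_\varphi$ has signature $(n+1,0)$ for every embedding $\varphi\neq\tau,\overline{\tau}$.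 Let $\tau$ be an embedding such that $h_\tau$ has signature $(n,1)$, put $V=V_\tau$, and let $\mathbb{C}H^n$ be the space of complex lines in $V$ that are negative for $h_\tau$. For $r\in\Lambda$ with $h(r,r)=1$, let $H_r\subset\mathbb{C}H^n$ be the set of negative lines that are orthogonal to the image of $r$ in $V$ with respect to $h_\tau$. If $r,t\in\Lambda$ satisfy $h(r,r)=h(t,t)=1$, $H_r\neq H_t$ and $H_r\cap H_t\neq\emptyset$, then $h(r,t)=0$. In other words, the arrangement of the hyperplanes $H_r$, for $r\in\Lambda$ with $h(r,r)=1$, is orthogonal: any two different members of it that meet are orthogonal at each point of their intersection, i.e. their normal spaces in the tangent space of $\mathbb{C}H^n$ at that point are orthogonal. -/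

import Mathlib

open NumberField
open scoped TensorProduct ComplexConjugate LinearAlgebra.Projectivization

noncomputable section

namespace HermitianLattice

/-! ### Hermitian forms over the ring of integers of a CM field -/

section Lattice

variable (K : Type*) [Field K] [NumberField K] [IsCMField K]

/-- The canonical involution `σ` of a CM field `K` (which every embedding of `K` into `ℂ`
intertwines with complex conjugation), on the ring of integers `𝓞 K`. -/
def sigma : 𝓞 K →+* 𝓞 K :=
  (IsCMField.ringOfIntegersComplexConj K : 𝓞 K →+* 𝓞 K)

variable (Λ : Type*) [AddCommGroup Λ] [Module (𝓞 K) Λ]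

/-- Sesquilinear forms `h : Λ × Λ → 𝓞 K`: linear in the first argument and `σ`-linear in the
second one. -/
abbrev LatticeForm := Λ →ₗ[𝓞 K] Λ →ₛₗ[sigma K] 𝓞 K

variable {K Λ}

/-- `(K, Λ)` with the form `h` is a hermitian lattice of rank `N`: `Λ` is a free `𝓞 K`-module of
rank `N`, and `h` is non-degenerate with `h(y, x) = σ(h(x, y))`. -/
structure IsHermitianLattice (h : LatticeForm K Λ) (N : ℕ) : Prop where
  free : Module.Free (𝓞 K) Λ
  finite : Module.Finite (𝓞 K) Λ
  rank_eq : Module.finrank (𝓞 K) Λ = N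
  conj_symm : ∀ x y : Λ, h y x = sigma K (h x y)
  nondegenerate : h.Nondegenerate

/-! ### The complex hermitian spaces attached to the embeddings of `K` -/

/-- The `𝓞 K`-algebra structure on `ℂ` given by an embedding `φ : K → ℂ`. -/
@[reducible] def embeddingAlgebra (φ : K →+* ℂ) : Algebra (𝓞 K) ℂ :=
  (φ.comp (algebraMap (𝓞 K) K)).toAlgebra

variable (Λ) in
/-- The complex vector space `V_φ = ℂ ⊗ Λ`, the tensor product over `𝓞 K` along `φ : K → ℂ`. -/
def Space (φ : K →+* ℂ) : Type _ :=
  letI := embeddingAlgebra φ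
  ℂ ⊗[𝓞 K] Λ

instance (φ : K →+* ℂ) : AddCommGroup (Space Λ φ) :=
  letI := embeddingAlgebra φ
  TensorProduct.addCommGroup (R := 𝓞 K) (M := ℂ) (N := Λ)

instance (φ : K →+* ℂ) : Module ℂ (Space Λ φ) :=
  letI := embeddingAlgebra φ
  TensorProduct.leftModule (R := 𝓞 K) (R'' := ℂ) (M := ℂ) (N := Λ)

/-- The pure tensor `a ⊗ x` in `V_φ`. -/
def tmul (φ : K →+* ℂ) (a : ℂ) (x : Λ) : Space Λ φ :=
  letI := embeddingAlgebra φ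
  a ⊗ₜ[𝓞 K] x

/-- The canonical map `Λ → V_φ`, `x ↦ x_φ = 1 ⊗ x`. -/
def toSpace (φ : K →+* ℂ) (x : Λ) : Space Λ φ := tmul φ 1 x

/-- For `y ∈ Λ`, the `ℂ`-linear functional on `V_φ` with `a ⊗ x ↦ a * φ(h(x, y))`. -/
def formLeft (h : LatticeForm K Λ) (φ : K →+* ℂ) (y : Λ) : Space Λ φ →ₗ[ℂ] ℂ :=
  letI := embeddingAlgebra φ
  LinearMap.liftBaseChange ℂ
    ({ toFun := fun x => φ (h x y : 𝓞 K)
       map_add' := fun x x' => by simp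
       map_smul' := fun c x => by simp [Algebra.smul_def, RingHom.algebraMap_toAlgebra] } :
      Λ →ₗ[𝓞 K] ℂ)

theorem formLeft_tmul (h : LatticeForm K Λ) (φ : K →+* ℂ) (y : Λ) (a : ℂ) (x : Λ) :
    formLeft h φ y (tmul φ a x) = a * φ (h x y : 𝓞 K) := by
  let := embeddingAlgebra φ
  exact LinearMap.liftBaseChange_tmul ..

theorem space_induction {φ : K →+* ℂ} {P : Space Λ φ → Prop} (v : Space Λ φ) (zero : P 0)
    (tmul : ∀ a x, P (tmul φ a x)) (add : ∀ v w, P v → P w → P (v + w)) : P v := by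
  let := embeddingAlgebra φ
  exact TensorProduct.induction_on (motive := P) v zero tmul add

theorem linearMap_ext {φ : K →+* ℂ} {f g : Space Λ φ →ₗ[ℂ] ℂ}
    (H : ∀ a x, f (tmul φ a x) = g (tmul φ a x)) : f = g := by
  ext v
  induction v using space_induction with
  | zero => simp
  | tmul a x => exact H a x
  | add v w hv hw => rw [map_add, map_add, hv, hw]

theorem formLeft_add (h : LatticeForm K Λ) (φ : K →+* ℂ) (y y' : Λ) :
    formLeft h φ (y + y') = formLeft h φ y + formLeft h φ y' :=
  linearMap_ext fun a x => by
    simp only [LinearMap.add_apply, formLeft_tmul, map_add, mul_add]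

theorem formLeft_smul (h : LatticeForm K Λ) (φ : K →+* ℂ) (c : 𝓞 K) (y : Λ) :
    formLeft h φ (c • y) = conj (φ c) • formLeft h φ y :=
  linearMap_ext fun a x => by
    have hc : φ (sigma K c : 𝓞 K) = conj (φ c) :=
      IsCMField.complexEmbedding_complexConj K φ c
    rw [LinearMap.smul_apply, formLeft_tmul, formLeft_tmul, LinearMap.map_smulₛₗ, smul_eq_mul,
      show ((sigma K c * h x y : 𝓞 K) : K) = (sigma K c : 𝓞 K) * (h x y : 𝓞 K) from map_mul _ _ _,
      map_mul, hc, smul_eq_mul]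
    ring

/-- The map `V_φ → V_φ^*`, `b ⊗ y ↦ conj b • h_φ(-, y)`, as a map of additive groups. -/
def formRight (h : LatticeForm K Λ) (φ : K →+* ℂ) :
    Space Λ φ →+ (Space Λ φ →ₗ[ℂ] ℂ) :=
  letI := embeddingAlgebra φ
  TensorProduct.liftAddHom (R := 𝓞 K) (M := ℂ) (N := Λ)
    (AddMonoidHom.mk'
      (fun b => AddMonoidHom.mk' (fun y => conj b • formLeft h φ y)
        fun y y' => by rw [formLeft_add, smul_add])
      fun b b' => by
        ext1 y
        change conj (b + b') • formLeft h φ y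
          = conj b • formLeft h φ y + conj b' • formLeft h φ y
        rw [map_add, add_smul])
    fun c b y => by
      change conj (φ c * b) • formLeft h φ y = conj b • formLeft h φ (c • y)
      rw [formLeft_smul, smul_smul, map_mul, mul_comm]

theorem formRight_tmul (h : LatticeForm K Λ) (φ : K →+* ℂ) (b : ℂ) (y : Λ) :
    formRight h φ (tmul φ b y) = conj b • formLeft h φ y := rfl

theorem smul_tmul' (φ : K →+* ℂ) (c b : ℂ) (y : Λ) :
    c • tmul φ b y = tmul φ (c * b) y := rfl

theorem formRight_smul (h : LatticeForm K Λ) (φ : K →+* ℂ) (c : ℂ) (w : Space Λ φ) :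
    formRight h φ (c • w) = conj c • formRight h φ w := by
  induction w using space_induction with
  | zero => simp
  | tmul b y => rw [smul_tmul', formRight_tmul, formRight_tmul, map_mul, mul_smul]
  | add v w hv hw => rw [smul_add, map_add, map_add, hv, hw, smul_add]

/-- The form `h_φ : V_φ × V_φ → ℂ` induced by `h` and `φ`, which is linear in the first argument
and conjugate-linear in the second one:
`h_φ(a ⊗ x, b ⊗ y) = a * conj b * φ(h(x, y))` (see `form_tmul_tmul`). -/
def form (h : LatticeForm K Λ) (φ : K →+* ℂ) :
    Space Λ φ →ₗ[ℂ] Space Λ φ →ₛₗ[starRingEnd ℂ] ℂ :=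
  LinearMap.mk₂'ₛₗ (RingHom.id ℂ) (starRingEnd ℂ) (fun v w => formRight h φ w v)
    (fun v v' w => map_add _ v v')
    (fun c v w => map_smul _ c v)
    (fun v w w' => by rw [map_add, LinearMap.add_apply])
    (fun c v w => by rw [formRight_smul, LinearMap.smul_apply])

theorem form_tmul_tmul (h : LatticeForm K Λ) (φ : K →+* ℂ) (a b : ℂ) (x y : Λ) :
    form h φ (tmul φ a x) (tmul φ b y) = a * conj b * φ (h x y : 𝓞 K) := by
  change conj b • formLeft h φ y (tmul φ a x) = _
  rw [formLeft_tmul, smul_eq_mul]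
  ring

end Lattice

/-! ### Signature, negative lines and hyperplanes in a complex hermitian space -/

section Geometry

variable {V : Type*} [AddCommGroup V] [Module ℂ V]

/-- The form `B` has signature `(p, q)`: in some basis, its matrix is diagonal with `p` entries
equal to `1` and `q` entries equal to `-1`. -/
def HasSignature (B : V →ₗ[ℂ] V →ₛₗ[starRingEnd ℂ] ℂ) (p q : ℕ) : Prop :=
  ∃ e : Module.Basis (Fin p ⊕ Fin q) ℂ V,
    ∀ i j, B (e i) (e j) = Matrix.diagonal (Sum.elim (fun _ => (1 : ℂ)) (fun _ => -1)) i j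

/-- The space of negative lines in `V`; this is the complex hyperbolic space `ℂHⁿ` if `B` is a
hermitian form of signature `(n, 1)`. -/
def hyperbolicSpace (B : V →ₗ[ℂ] V →ₛₗ[starRingEnd ℂ] ℂ) : Set (ℙ ℂ V) :=
  {ℓ | ∀ x ∈ ℓ.submodule, x ≠ 0 → (B x x).re < 0}

/-- The hyperplane `H_r` of negative lines orthogonal to `r`. -/
def hyperplane (B : V →ₗ[ℂ] V →ₛₗ[starRingEnd ℂ] ℂ) (r : V) : Set (ℙ ℂ V) :=
  {ℓ | ℓ ∈ hyperbolicSpace B ∧ ∀ x ∈ ℓ.submodule, B x r = 0}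

/-- The orthogonal complement `ℓ^⊥` of a line `ℓ`. The tangent space of `ℂHⁿ` at `ℓ` is
`Hom(ℓ, ℓ^⊥)`, so that the choice of a non-zero vector in `ℓ` identifies it with `ℓ^⊥`, and its
hermitian metric with a positive multiple of `B`. -/
def tangentSpace (B : V →ₗ[ℂ] V →ₛₗ[starRingEnd ℂ] ℂ) (ℓ : ℙ ℂ V) : Set V :=
  {v | ∀ x ∈ ℓ.submodule, B v x = 0}

/-- The tangent space of the hyperplane `H_r` at `ℓ ∈ H_r`, in `ℓ^⊥`. -/
def hyperplaneTangent (B : V →ₗ[ℂ] V →ₛₗ[starRingEnd ℂ] ℂ) (r : V) (ℓ : ℙ ℂ V) : Set V :=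
  {v | v ∈ tangentSpace B ℓ ∧ B v r = 0}

/-- The normal space of the hyperplane `H_r` at `ℓ ∈ H_r`, in `ℓ^⊥`. -/
def hyperplaneNormal (B : V →ₗ[ℂ] V →ₛₗ[starRingEnd ℂ] ℂ) (r : V) (ℓ : ℙ ℂ V) : Set V :=
  {v | v ∈ tangentSpace B ℓ ∧ ∀ w ∈ hyperplaneTangent B r ℓ, B v w = 0}

/-- The arrangement of the hyperplanes `H_r`, for `r ∈ R`, is orthogonal: whenever two different
members of it meet, they are orthogonal at each point of their intersection, that is, their normal
spaces there are orthogonal. -/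
def IsOrthogonalArrangement (B : V →ₗ[ℂ] V →ₛₗ[starRingEnd ℂ] ℂ) (R : Set V) : Prop :=
  ∀ r ∈ R, ∀ t ∈ R, hyperplane B r ≠ hyperplane B t →
    ∀ ℓ ∈ hyperplane B r ∩ hyperplane B t,
      ∀ u ∈ hyperplaneNormal B r ℓ, ∀ v ∈ hyperplaneNormal B t ℓ, B u v = 0

end Geometry

/-! ### Admissible hermitian lattices -/

/-- The hermitian lattice `(K, Λ)` with form `h` is admissible, of rank `n + 1`: the different
ideal of `K` is generated by an element `η` with `σ(η) = -η`, and `h` has signature `(n, 1)` at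
one embedding `τ : K → ℂ` and its complex conjugate, and signature `(n + 1, 0)` at all other
embeddings. (Pairs of conjugate embeddings of `K` into `ℂ` correspond to embeddings into `ℝ` of
the maximal totally real subfield of `K`.) -/
structure IsAdmissible {K : Type*} [Field K] [NumberField K] [IsCMField K]
    {Λ : Type*} [AddCommGroup Λ] [Module (𝓞 K) Λ] (h : LatticeForm K Λ) (n : ℕ) : Prop where
  isHermitianLattice : IsHermitianLattice h (n + 1)
  different : ∃ η : 𝓞 K, differentIdeal ℤ (𝓞 K) = Ideal.span {η} ∧ sigma K η = -η
  signature : ∃ τ : K →+* ℂ, HasSignature (form h τ) n 1 ∧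
    ∀ φ : K →+* ℂ, φ ≠ τ → φ ≠ ComplexEmbedding.conjugate τ → HasSignature (form h φ) (n + 1) 0

end HermitianLattice

end

/-!
Put `a = h(r, t)`. At an embedding `φ` where `h_φ` is positive definite, Cauchy-Schwarz for the unit
vectors `r_φ`, `t_φ` gives `|φ(a)| ≤ 1`. At `τ`, a common point of `H_r` and `H_t` is a negative
line `ℓ`, and `r_τ`, `t_τ` lie in `ℓ^⊥`, which is positive definite because the signature is `(n, 1)`
(`pos_of_orthogonal_of_neg`); so Cauchy-Schwarz applies again, with equality only if `t_τ` is a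
multiple of `r_τ` (`eq_smul_of_unit_of_one_le_norm`), which would force `H_r = H_t`. Hence
`|τ(a)| < 1`, and the norm of `a`, a rational integer, has absolute value
`∏_φ |φ(a)| < 1`. So `a = 0` (`eq_zero_of_norm_embedding_le_one`).

For the geometric form, the normal space of `H_r` at `ℓ` is contained in the line spanned by `r_τ`
(`eq_smul_of_mem_hyperplaneNormal`), again by definiteness of `ℓ^⊥`, and `h_τ(r_τ, t_τ) = τ(a)`.
-/

namespace HermitianLattice

/-- If an algebraic integer has absolute value at most one at every embedding, and less than one
at some embedding, then its norm is an integer of absolute value less than one, so it vanishes. -/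
theorem eq_zero_of_norm_embedding_le_one {K : Type*} [Field K] [NumberField K] (a : 𝓞 K)
    (hle : ∀ φ : K →+* ℂ, ‖φ a‖ ≤ 1) (τ : K →+* ℂ) (hlt : ‖τ a‖ < 1) : a = 0 := by
  by_contra ha
  have hprod : ∏ φ : K →+* ℂ, ‖φ a‖ < 1 := by
    have := Finset.prod_lt_prod (s := Finset.univ) (f := fun φ : K →+* ℂ => ‖φ a‖)
      (g := fun _ => (1 : ℝ)) (fun φ _ => norm_pos_iff.2 (by simpa using ha))
      (fun φ _ => hle φ) ⟨τ, Finset.mem_univ _, hlt⟩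
    simpa using this
  have hnorm : ∏ φ : K →+* ℂ, ‖φ a‖ = |(Algebra.norm ℤ a : ℝ)| := by
    have h1 := Algebra.norm_eq_prod_embeddings ℚ ℂ (a : K)
    rw [← Fintype.prod_equiv (RingHom.equivRatAlgHom K ℂ) (fun φ : K →+* ℂ => φ a)
      (fun φ : K →ₐ[ℚ] ℂ => φ a) (fun _ => rfl), ← Algebra.coe_norm_int] at h1
    rw [← norm_prod, ← h1]
    simp
  rw [hnorm] at hprod
  have h2 : |Algebra.norm ℤ a| < 1 := by exact_mod_cast hprod
  exact ha (Algebra.norm_eq_zero_iff.1 (Int.abs_lt_one_iff.1 h2))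

section Geometry

variable {V : Type*} [AddCommGroup V] [Module ℂ V] {B : V →ₗ[ℂ] V →ₛₗ[starRingEnd ℂ] ℂ}

theorem apply_eq_sum_of_diagonal {p q : ℕ} (e : Module.Basis (Fin p ⊕ Fin q) ℂ V)
    (he : ∀ i j, B (e i) (e j) =
      Matrix.diagonal (Sum.elim (fun _ => (1 : ℂ)) (fun _ => -1)) i j) (v w : V) :
    B v w = ∑ i, e.repr v (.inl i) * conj (e.repr w (.inl i)) -
      ∑ i, e.repr v (.inr i) * conj (e.repr w (.inr i)) := by
  conv_lhs => rw [← e.sum_repr v, ← e.sum_repr w]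
  simp only [map_sum, LinearMap.sum_apply, map_smul, LinearMap.smul_apply, LinearMap.map_smulₛₗ, he,
    Matrix.diagonal_apply]
  simp [sub_eq_add_neg, mul_comm]

theorem HasSignature.conj_symm {p q : ℕ} (hB : HasSignature B p q) (v w : V) :
    B v w = conj (B w v) := by
  obtain ⟨e, he⟩ := hB
  simp [apply_eq_sum_of_diagonal e he, mul_comm]

theorem HasSignature.re_self_pos {p : ℕ} (hB : HasSignature B p 0) {v : V} (hv : v ≠ 0) :
    0 < (B v v).re := by
  obtain ⟨e, he⟩ := hB
  have hsum : (B v v).re = ∑ i, ‖e.repr v (.inl i)‖ ^ 2 := by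
    simp [apply_eq_sum_of_diagonal e he, Complex.mul_conj, Complex.normSq_eq_norm_sq,
      -Complex.ofReal_pow]
  rw [hsum]
  refine lt_of_le_of_ne (by positivity) fun h0 => hv ?_
  rw [eq_comm, Finset.sum_eq_zero_iff_of_nonneg fun _ _ => by positivity] at h0
  refine e.ext_elem fun i => ?_
  rcases i with i | i
  · simpa using h0 i (Finset.mem_univ _)
  · exact i.elim0

/-- In signature `(p, 1)`, the orthogonal complement of a negative vector is positive definite. -/
theorem HasSignature.pos_of_orthogonal_of_neg {p : ℕ} (hB : HasSignature B p 1) {x v : V}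
    (hx : (B x x).re < 0) (hvx : B v x = 0) (hv : v ≠ 0) : 0 < (B v v).re := by
  obtain ⟨e, he⟩ := hB
  -- The coordinates of a vector split into a positive part in `ℂ^p` and a negative one in `ℂ`.
  let P (w : V) : EuclideanSpace ℂ (Fin p) := WithLp.toLp 2 fun i => e.repr w (.inl i)
  let N (w : V) : ℂ := e.repr w (.inr 0)
  have hB (v w : V) : B v w = inner ℂ (P w) (P v) - N v * conj (N w) := by
    simp [apply_eq_sum_of_diagonal e he, P, N, PiLp.inner_apply]
  have hself (w : V) : (B w w).re = ‖P w‖ ^ 2 - ‖N w‖ ^ 2 := by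
    rw [hB, inner_self_eq_norm_sq_to_K, Complex.mul_conj, Complex.normSq_eq_norm_sq]
    simp [← Complex.ofReal_pow]
  have hcs : ‖N v‖ * ‖N x‖ ≤ ‖P x‖ * ‖P v‖ := by
    have h1 : inner ℂ (P x) (P v) = N v * conj (N x) := by rw [← sub_eq_zero, ← hB, hvx]
    simpa [h1] using norm_inner_le_norm (𝕜 := ℂ) (P x) (P v)
  have hPN : ‖P x‖ < ‖N x‖ := by
    rw [hself] at hx
    exact lt_of_pow_lt_pow_left₀ 2 (norm_nonneg _) (by linarith)
  have hNx : 0 < ‖N x‖ := (norm_nonneg _).trans_lt hPN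
  have hPv : 0 < ‖P v‖ := by
    refine lt_of_le_of_ne (norm_nonneg _) fun h0 => hv ?_
    have hNv : N v = 0 := by
      rw [← h0, mul_zero] at hcs
      exact norm_le_zero_iff.1 (nonpos_of_mul_nonpos_left hcs hNx)
    have hPv : P v = 0 := norm_eq_zero.1 h0.symm
    refine e.ext_elem fun i => ?_
    rcases i with i | i
    · simpa [P] using congrArg (fun u : EuclideanSpace ℂ (Fin p) => u i) hPv
    · rw [Subsingleton.elim i 0]
      simpa [N] using hNv
  have hlt : ‖N v‖ < ‖P v‖ := by
    refine lt_of_mul_lt_mul_right (hcs.trans_lt ?_) hNx.le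
    rw [mul_comm]
    gcongr
  rw [hself, sub_pos]
  gcongr

theorem self_sub_smul_unit {r t : V} (hsymm : ∀ v w, B v w = conj (B w v))
    (hr : B r r = 1) (ht : B t t = 1) :
    (B (t - B t r • r) (t - B t r • r)).re = 1 - ‖B t r‖ ^ 2 := by
  have : B (t - B t r • r) (t - B t r • r) = 1 - B t r * conj (B t r) := by
    simp only [map_sub, LinearMap.sub_apply, map_smul, LinearMap.smul_apply,
      LinearMap.map_smulₛₗ, hr, ht, hsymm r t, smul_eq_mul]
    ring
  rw [this, Complex.mul_conj, Complex.normSq_eq_norm_sq]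
  simp [-Complex.ofReal_pow]

/-- The Cauchy-Schwarz inequality for unit vectors, with its case of equality; only the
definiteness of the form on the projection of `t` to the orthogonal complement of `r` is used. -/
theorem eq_smul_of_unit_of_one_le_norm {r t : V} (hsymm : ∀ v w, B v w = conj (B w v))
    (hr : B r r = 1) (ht : B t t = 1)
    (hpos : t - B t r • r ≠ 0 → 0 < (B (t - B t r • r) (t - B t r • r)).re)
    (hle : 1 ≤ ‖B t r‖) : t = B t r • r := by
  by_contra hne
  have := hpos (sub_ne_zero.2 hne)
  rw [self_sub_smul_unit hsymm hr ht] at this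
  nlinarith

theorem norm_apply_le_one_of_unit {r t : V} (hsymm : ∀ v w, B v w = conj (B w v))
    (hr : B r r = 1) (ht : B t t = 1) (hpos : ∀ v ≠ 0, 0 < (B v v).re) : ‖B t r‖ ≤ 1 := by
  by_contra! hlt
  have h0 := eq_smul_of_unit_of_one_le_norm hsymm hr ht (hpos _) hlt.le
  have h1 := self_sub_smul_unit hsymm hr ht
  rw [← h0] at h1
  simp at h1
  nlinarith

theorem hyperplane_smul (r : V) {c : ℂ} (hc : c ≠ 0) :
    hyperplane B (c • r) = hyperplane B r := by
  ext ℓ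
  simp [hyperplane, LinearMap.map_smulₛₗ, hc]

theorem rep_neg_of_mem_hyperbolicSpace {ℓ : ℙ ℂ V} (hℓ : ℓ ∈ hyperbolicSpace B) :
    (B ℓ.rep ℓ.rep).re < 0 :=
  hℓ _ (by rw [ℓ.submodule_eq]; exact Submodule.mem_span_singleton_self _) ℓ.rep_nonzero

theorem apply_rep_eq_zero_of_mem_hyperplane (hsymm : ∀ v w, B v w = conj (B w v)) {r : V}
    {ℓ : ℙ ℂ V} (hℓ : ℓ ∈ hyperplane B r) : B r ℓ.rep = 0 := by
  rw [hsymm, hℓ.2 _ (by rw [ℓ.submodule_eq]; exact Submodule.mem_span_singleton_self _), map_zero]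

/-- Two unit vectors whose hyperplanes are different but meet have a product of absolute value
less than one. -/
theorem HasSignature.norm_apply_lt_one {p : ℕ} (hB : HasSignature B p 1) {r t : V}
    (hr : B r r = 1) (ht : B t t = 1) (hne : hyperplane B r ≠ hyperplane B t)
    (hmeet : (hyperplane B r ∩ hyperplane B t).Nonempty) : ‖B t r‖ < 1 := by
  obtain ⟨ℓ, hℓr, hℓt⟩ := hmeet
  by_contra! hle
  have hrx := apply_rep_eq_zero_of_mem_hyperplane hB.conj_symm hℓr
  have htx := apply_rep_eq_zero_of_mem_hyperplane hB.conj_symm hℓt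
  have heq := eq_smul_of_unit_of_one_le_norm hB.conj_symm hr ht
    (hB.pos_of_orthogonal_of_neg (rep_neg_of_mem_hyperbolicSpace hℓr.1) (by simp [hrx, htx])) hle
  have hc : B t r ≠ 0 := norm_pos_iff.1 (zero_lt_one.trans_le hle)
  exact hne (by rw [heq, hyperplane_smul _ hc])

/-- The normal space of `H_r` at a point is contained in the line spanned by the unit
vector `r`. -/
theorem HasSignature.eq_smul_of_mem_hyperplaneNormal {p : ℕ} (hB : HasSignature B p 1) {r v : V}
    (hr : B r r = 1) {ℓ : ℙ ℂ V} (hℓ : ℓ ∈ hyperplane B r) (hv : v ∈ hyperplaneNormal B r ℓ) :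
    v = B v r • r := by
  -- The projection of `v` to `r^⊥` is tangent to `H_r`, hence orthogonal to `v` and to itself.
  have htan : v - B v r • r ∈ hyperplaneTangent B r ℓ := by
    refine ⟨fun x hx => ?_, by simp [hr]⟩
    have hrx : B r x = 0 := by rw [hB.conj_symm, hℓ.2 x hx, map_zero]
    simp [hv.1 x hx, hrx]
  have hself : B (v - B v r • r) (v - B v r • r) = 0 := by
    have hrw : B r (v - B v r • r) = 0 := by rw [hB.conj_symm, htan.2, map_zero]
    rw [LinearMap.map_sub₂, hv.2 _ htan, LinearMap.map_smul₂, hrw, smul_zero, sub_zero]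
  by_contra hne
  have := hB.pos_of_orthogonal_of_neg (rep_neg_of_mem_hyperbolicSpace hℓ.1)
    (htan.1 _ (by rw [ℓ.submodule_eq]; exact Submodule.mem_span_singleton_self _))
    (sub_ne_zero.2 hne)
  simp only [hself, Complex.zero_re, lt_irrefl] at this

end Geometry

theorem form_toSpace {K : Type*} [Field K] [NumberField K] [IsCMField K] {Λ : Type*}
    [AddCommGroup Λ] [Module (𝓞 K) Λ] (h : LatticeForm K Λ) (φ : K →+* ℂ) (x y : Λ) :
    form h φ (toSpace φ x) (toSpace φ y) = φ (h x y : 𝓞 K) := by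
  simp [toSpace, form_tmul_tmul]

theorem IsAdmissible.apply_eq_zero {K : Type*} [Field K] [NumberField K] [IsCMField K]
    {Λ : Type*} [AddCommGroup Λ] [Module (𝓞 K) Λ] {h : LatticeForm K Λ} {n : ℕ}
    (hadm : IsAdmissible h n) {τ : K →+* ℂ} (hτ : HasSignature (form h τ) n 1) {r t : Λ}
    (hr : h r r = 1) (ht : h t t = 1)
    (hne : hyperplane (form h τ) (toSpace τ r) ≠ hyperplane (form h τ) (toSpace τ t))
    (hmeet : (hyperplane (form h τ) (toSpace τ r) ∩
      hyperplane (form h τ) (toSpace τ t)).Nonempty) : h r t = 0 := by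
  have hunit (φ : K →+* ℂ) {x : Λ} (hx : h x x = 1) :
      form h φ (toSpace φ x) (toSpace φ x) = 1 := by simp [form_toSpace, hx]
  have hlt : ‖τ (h t r : 𝓞 K)‖ < 1 := by
    simpa [form_toSpace] using hτ.norm_apply_lt_one (hunit τ hr) (hunit τ ht) hne hmeet
  obtain ⟨ρ, -, hρ⟩ := hadm.signature
  -- A negative line exists at `τ`, so the form there is not positive definite.
  have hτρ : τ = ρ ∨ τ = ComplexEmbedding.conjugate ρ := by
    by_contra! hcon
    obtain ⟨ℓ, hℓ, -⟩ := hmeet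
    exact lt_asymm (rep_neg_of_mem_hyperbolicSpace hℓ.1)
      ((hρ τ hcon.1 hcon.2).re_self_pos ℓ.rep_nonzero)
  have hle (φ : K →+* ℂ) : ‖φ (h t r : 𝓞 K)‖ ≤ 1 := by
    by_cases hφ : φ ≠ ρ ∧ φ ≠ ComplexEmbedding.conjugate ρ
    · have hpos := hρ φ hφ.1 hφ.2
      simpa [form_toSpace] using norm_apply_le_one_of_unit hpos.conj_symm (hunit φ hr)
        (hunit φ ht) fun v hv => hpos.re_self_pos hv
    · have hφρ : φ = ρ ∨ φ = ComplexEmbedding.conjugate ρ := by tauto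
      -- `φ` and `τ` agree up to complex conjugation.
      have heq : ‖φ (h t r : 𝓞 K)‖ = ‖τ (h t r : 𝓞 K)‖ := by
        rcases hφρ with rfl | rfl <;> rcases hτρ with rfl | rfl <;>
          simp [ComplexEmbedding.conjugate_coe_eq]
      exact heq.trans_le hlt.le
  rw [hadm.isHermitianLattice.conj_symm t r, eq_zero_of_norm_embedding_le_one _ hle τ hlt,
    map_zero]

end HermitianLattice

theorem theorem2p5 {K : Type*} [Field K] [NumberField K] [NumberField.IsCMField K]
    {Λ : Type*} [AddCommGroup Λ] [Module (NumberField.RingOfIntegers K) Λ]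
    (h : HermitianLattice.LatticeForm K Λ) (n : ℕ) (hn : 1 ≤ n)
    (hadm : HermitianLattice.IsAdmissible h n)
    (τ : K →+* ℂ) (hτ : HermitianLattice.HasSignature (HermitianLattice.form h τ) n 1) :
    (∀ r t : Λ, h r r = 1 → h t t = 1 →
      HermitianLattice.hyperplane (HermitianLattice.form h τ) (HermitianLattice.toSpace τ r) ≠
        HermitianLattice.hyperplane (HermitianLattice.form h τ) (HermitianLattice.toSpace τ t) →
      (HermitianLattice.hyperplane (HermitianLattice.form h τ) (HermitianLattice.toSpace τ r) ∩
        HermitianLattice.hyperplane (HermitianLattice.form h τ)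
          (HermitianLattice.toSpace τ t)).Nonempty →
      h r t = 0) ∧
    HermitianLattice.IsOrthogonalArrangement (HermitianLattice.form h τ)
      (HermitianLattice.toSpace τ '' {r : Λ | h r r = 1}) := by
  refine ⟨fun r t hr ht hne hmeet => hadm.apply_eq_zero hτ hr ht hne hmeet, ?_⟩
  rintro _ ⟨r, hr, rfl⟩ _ ⟨t, ht, rfl⟩ hne ℓ hℓ u hu v hv
  have hrt := hadm.apply_eq_zero hτ hr ht hne ⟨ℓ, hℓ⟩
  rw [hτ.eq_smul_of_mem_hyperplaneNormal
      (by simp [HermitianLattice.form_toSpace, show h r r = 1 from hr]) hℓ.1 hu,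
    hτ.eq_smul_of_mem_hyperplaneNormal
      (by simp [HermitianLattice.form_toSpace, show h t t = 1 from ht]) hℓ.2 hv]
  simp [LinearMap.map_smulₛₗ, HermitianLattice.form_toSpace, hrt]
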